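/- All Banach spaces are real; fix $1\le p<\infty$ with conjugate exponent $p'$ ($p'=\infty$ if $p=1$). A subset $K$ of a Banach space $X$ is *relatively $p$-compact* if there is a sequence $(x_n)$ in $X$ with $\sum_n\|x_n\|^p<\infty$ and $K\subset\{\sum_n a_nx_n:(a_n)\in B_{\ell_{p'}}\}$; it is *$p$-compact* if it is relatively $p$-compact and compact. Let $\tau_p$ be the topology of uniform convergence on the $p$-compact subsets of the domain space. Let $L(X,Y)$ be the space of bounded linear operators and $\mathcal F(X,Y)$ the subspace of finite-rank ones, and let $Lip_{0\mathcal F}(X,Y)$ be the set of Lipschitz maps $f:X\to Y$ with $f(0)=0$ whose range spans a finite-dimensional space. The space $X$ has the *$p$-approximation property* if for every $p$-compact $K\subset X$ and every $\epsilon>0$ there is $T\in\mathcal F(X,X)$ with $\|Tx-x\|<\epsilon$ for all $x\in K$; it has the *Lipschitz $p$-approximation property* if $Id_X\in\overline{Lip_{0\mathcal F}(X,X)}^{\tau_p}$. Let $X^{\#}$ be the Banach space of Lipschitz functions $f:X\to\mathbb R$ with $f(0)=0$, normed by the least Lipschitz constant, and let $F(X)=\overline{\operatorname{span}}\{\delta_x:x\in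 X\}\subset (X^{\#})^*$, where $\delta_x(f)=f(x)$, be the Lipschitz-free space of $X$. Let $\beta_X:F(X)\to X$ be the bounded linear map determined by $e^*(\beta_X\mu)=\mu(e^*)$ for $\mu\in F(X)$, $e^*\in X^*$ (so $\beta_X\delta_x=x$). Then, for every Banach space $X$: 1. For every Banach space $Y$: $L(X,Y)\subset\overline{\mathcal F(X,Y)}^{\tau_p}$ if and only if $T\beta_X\in\overline{\mathcal F(F(X),Y)}^{\tau_p}$ for all $T\in L(X,Y)$. 2. $X$ has the $p$-approximation property if and only if $T\beta_X\in\overline{\mathcal F(F(X),Y)}^{\tau_p}$ for every Banach space $Y$ and every $T\in L(X,Y)$. 3. If $F(X)$ has the $p$-approximation property, then $X$ has the $p$-approximation property and the Lipschitz $p$-approximation property. -/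

import Mathlib

open scoped ENNReal NNReal UniformConvergence

universe u v

noncomputable section

/-! ### Lipschitz operators vanishing at zero -/

/-- The vector space of all Lipschitz maps `f : X → Y` with `f 0 = 0`, inside all maps. -/
def lipZeroSubmodule (X : Type u) (Y : Type v) [NormedAddCommGroup X]
    [NormedAddCommGroup Y] [NormedSpace ℝ Y] : Submodule ℝ (X → Y) where
  carrier := {f | (∃ C : ℝ≥0, LipschitzWith C f) ∧ f 0 = 0}
  add_mem' := by
    rintro f g ⟨⟨C, hC⟩, hf⟩ ⟨⟨D, hD⟩, hg⟩
    exact ⟨⟨C + D, hC.add hD⟩, by simp [hf, hg]⟩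
  zero_mem' := ⟨⟨0, LipschitzWith.const 0⟩, rfl⟩
  smul_mem' := by
    rintro c f ⟨⟨C, hC⟩, hf⟩
    refine ⟨⟨‖c‖₊ * C, LipschitzWith.of_dist_le_mul fun x y => ?_⟩, by simp [hf]⟩
    have h := hC.dist_le_mul x y
    simp only [Pi.smul_apply, dist_smul₀, NNReal.coe_mul, coe_nnnorm, mul_assoc]
    exact mul_le_mul_of_nonneg_left h (norm_nonneg c)

/-- `Lip₀(X, Y)`. This is a type of its own, so that it carries the Lipschitz norm below
and not the topology of pointwise convergence of `X → Y`. -/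
def LipZero (X : Type u) (Y : Type v) [NormedAddCommGroup X]
    [NormedAddCommGroup Y] [NormedSpace ℝ Y] : Type (max u v) :=
  ↥(lipZeroSubmodule X Y)

namespace LipZero

variable {X : Type u} {Y : Type v} [NormedAddCommGroup X]
  [NormedAddCommGroup Y] [NormedSpace ℝ Y]

instance : AddCommGroup (LipZero X Y) := inferInstanceAs (AddCommGroup ↥(lipZeroSubmodule X Y))

instance : Module ℝ (LipZero X Y) := inferInstanceAs (Module ℝ ↥(lipZeroSubmodule X Y))

/-- The underlying map of an element of `Lip₀(X, Y)`. -/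
def toFun (f : LipZero X Y) : X → Y := f.1

instance : CoeFun (LipZero X Y) (fun _ => X → Y) := ⟨toFun⟩

theorem lipschitz (f : LipZero X Y) : ∃ C : ℝ≥0, LipschitzWith C f := f.2.1

theorem map_zero (f : LipZero X Y) : f 0 = 0 := f.2.2

theorem ext {f g : LipZero X Y} (h : ∀ x, f x = g x) : f = g := Subtype.ext (funext h)

theorem add_apply (f g : LipZero X Y) (x : X) : (f + g) x = f x + g x := rfl

theorem smul_apply (c : ℝ) (f : LipZero X Y) (x : X) : (c • f) x = c • f x := rfl

theorem zero_apply (x : X) : (0 : LipZero X Y) x = 0 := rfl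

/-- The Lipschitz norm: the supremum of the difference quotients. Pairs with `q.1 = q.2`
contribute `0 / 0 = 0`, which does not change the supremum. -/
instance : Norm (LipZero X Y) := ⟨fun f => ⨆ q : X × X, ‖f q.1 - f q.2‖ / ‖q.1 - q.2‖⟩

theorem norm_def (f : LipZero X Y) : ‖f‖ = ⨆ q : X × X, ‖f q.1 - f q.2‖ / ‖q.1 - q.2‖ := rfl

theorem bddAbove (f : LipZero X Y) :
    BddAbove (Set.range fun q : X × X => ‖f q.1 - f q.2‖ / ‖q.1 - q.2‖) := by
  obtain ⟨C, hC⟩ := f.lipschitz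
  refine ⟨C, ?_⟩
  rintro _ ⟨q, rfl⟩
  refine div_le_of_le_mul₀ (norm_nonneg _) C.2 ?_
  simpa [dist_eq_norm] using hC.dist_le_mul q.1 q.2

theorem norm_sub_le (f : LipZero X Y) (x y : X) : ‖f x - f y‖ ≤ ‖f‖ * ‖x - y‖ := by
  by_cases h : x = y
  · simp [h]
  · have hpos : 0 < ‖x - y‖ := norm_pos_iff.2 (sub_ne_zero.2 h)
    exact (div_le_iff₀ hpos).1 (le_ciSup f.bddAbove (x, y))

theorem norm_le_of_forall (f : LipZero X Y) {C : ℝ} (hC : 0 ≤ C)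
    (h : ∀ x y, ‖f x - f y‖ ≤ C * ‖x - y‖) : ‖f‖ ≤ C :=
  ciSup_le fun q => div_le_of_le_mul₀ (norm_nonneg _) hC (h q.1 q.2)

theorem norm_nonneg' (f : LipZero X Y) : 0 ≤ ‖f‖ :=
  Real.iSup_nonneg fun _ => by positivity

theorem norm_apply_le (f : LipZero X Y) (x : X) : ‖f x‖ ≤ ‖f‖ * ‖x‖ := by
  simpa [f.map_zero] using f.norm_sub_le x 0

theorem normCore : NormedSpace.Core ℝ (LipZero X Y) where
  norm_nonneg := norm_nonneg'
  norm_smul c f := by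
    rw [norm_def, norm_def, Real.mul_iSup_of_nonneg (norm_nonneg c)]
    congr 1
    ext q
    rw [smul_apply, smul_apply, ← smul_sub, norm_smul, mul_div_assoc]
  norm_triangle f g := by
    refine norm_le_of_forall _ (add_nonneg f.norm_nonneg' g.norm_nonneg') fun x y => ?_
    rw [add_apply, add_apply, add_sub_add_comm, add_mul]
    exact (norm_add_le _ _).trans (add_le_add (f.norm_sub_le x y) (g.norm_sub_le x y))
  norm_eq_zero_iff f := by
    constructor
    · intro h
      refine ext fun x => ?_
      have hx := f.norm_apply_le x
      rw [h, zero_mul] at hx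
      exact norm_le_zero_iff.1 hx
    · rintro rfl
      refine le_antisymm (norm_le_of_forall _ le_rfl fun x y => ?_) (norm_nonneg' _)
      simp [zero_apply]

instance : NormedAddCommGroup (LipZero X Y) := NormedAddCommGroup.ofCore normCore

instance : NormedSpace ℝ (LipZero X Y) := NormedSpace.ofCore normCore

end LipZero

/-! ### The Lipschitz-free space and its barycentre map -/

section LipFree

variable (X : Type u) [NormedAddCommGroup X]

/-- The Lipschitz dual `X^# = Lip₀(X, ℝ)`. -/
abbrev LipDual : Type u := LipZero X ℝ

variable {X} in
/-- The evaluation functional `δ_x : X^# → ℝ`, `f ↦ f x`. -/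
def evalAt (x : X) : StrongDual ℝ (LipDual X) :=
  LinearMap.mkContinuous
    { toFun := fun f : LipDual X => f x
      map_add' := fun _ _ => rfl
      map_smul' := fun _ _ => rfl } ‖x‖
    (fun f => (f.norm_apply_le x).trans_eq (mul_comm _ _))

/-- The Lipschitz-free space `F(X)`: the norm closure in `(X^#)*` of the span of the
evaluation functionals. -/
def lipFreeSubmodule : Submodule ℝ (StrongDual ℝ (LipDual X)) :=
  (Submodule.span ℝ (Set.range (evalAt (X := X)))).topologicalClosure

/-- The Lipschitz-free space `F(X)` as a normed space, with the norm of `(X^#)*`. -/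
abbrev LipFree : Type u := ↥(lipFreeSubmodule X)

instance : CompleteSpace (LipFree X) :=
  (Submodule.isClosed_topologicalClosure _).completeSpace_coe

variable {X} in
/-- The map `δ_X : X → F(X)`, `x ↦ δ_x`. -/
def lipDelta (x : X) : LipFree X :=
  ⟨evalAt x, Submodule.le_topologicalClosure _ (Submodule.subset_span ⟨x, rfl⟩)⟩

variable [NormedSpace ℝ X]

/-- The inclusion `X* → X^#` of the bounded linear functionals into the Lipschitz ones. -/
def dualToLip : StrongDual ℝ X →L[ℝ] LipDual X :=
  LinearMap.mkContinuous
    { toFun := fun e : StrongDual ℝ X =>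
        (⟨fun x => e x, ⟨‖e‖₊, e.lipschitz⟩, _root_.map_zero e⟩ : ↥(lipZeroSubmodule X ℝ))
      map_add' := fun _ _ => rfl
      map_smul' := fun _ _ => rfl } 1
    (fun e => LipZero.norm_le_of_forall _ (by positivity) fun x y => by
      have h := e.le_opNorm (x - y)
      rw [_root_.map_sub] at h
      rw [one_mul]
      exact h)

theorem dualToLip_apply (e : StrongDual ℝ X) (x : X) : dualToLip X e x = e x := rfl

/-- Restriction of `μ ∈ F(X)` to the linear functionals: a bounded linear map `F(X) → X**`. -/
def lipFreeToBidual : LipFree X →L[ℝ] StrongDual ℝ (StrongDual ℝ X) :=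
  ((ContinuousLinearMap.compL ℝ (StrongDual ℝ X) (LipDual X) ℝ).flip (dualToLip X)).comp
    (lipFreeSubmodule X).subtypeL

theorem lipFreeToBidual_apply (μ : LipFree X) (e : StrongDual ℝ X) :
    lipFreeToBidual X μ e = μ.1 (dualToLip X e) := rfl

variable [CompleteSpace X]

theorem lipFreeToBidual_mem_range (μ : LipFree X) :
    lipFreeToBidual X μ ∈
      LinearMap.range (NormedSpace.inclusionInDoubleDualLi (E := X) ℝ).toLinearMap := by
  set J := NormedSpace.inclusionInDoubleDualLi (E := X) ℝ
  set R : StrongDual ℝ (LipDual X) →L[ℝ] StrongDual ℝ (StrongDual ℝ X) :=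
    (ContinuousLinearMap.compL ℝ (StrongDual ℝ X) (LipDual X) ℝ).flip (dualToLip X) with hR
  have hclosed : IsClosed ((LinearMap.range J.toLinearMap : Submodule ℝ _) : Set
      (StrongDual ℝ (StrongDual ℝ X))) := by
    have h : IsClosed (Set.range J) :=
      (J.isometry.isUniformInducing.isComplete_range).isClosed
    exact h
  have hle : lipFreeSubmodule X ≤ (LinearMap.range J.toLinearMap).comap R.toLinearMap := by
    refine Submodule.topologicalClosure_minimal _ ?_ (hclosed.preimage R.continuous)
    refine Submodule.span_le.2 ?_
    rintro _ ⟨x, rfl⟩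
    exact ⟨x, rfl⟩
  exact hle μ.2

/-- The quotient map `β_X : F(X) → X`: the element `β_X μ` of `X` is the one whose canonical
image in `X**` is `e ↦ μ e`. -/
def lipBeta : LipFree X →L[ℝ] X :=
  ((NormedSpace.inclusionInDoubleDualLi (E := X) ℝ).equivRange.symm :
      _ →L[ℝ] X).comp
    ((lipFreeToBidual X).codRestrict _ (lipFreeToBidual_mem_range X))

/-- The defining property of `β_X`: `e (β_X μ) = μ e` for `e ∈ X*`. -/
theorem dual_lipBeta (μ : LipFree X) (e : StrongDual ℝ X) :
    e (lipBeta X μ) = μ.1 (dualToLip X e) := by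
  have h := (NormedSpace.inclusionInDoubleDualLi (E := X) ℝ).equivRange.apply_symm_apply
    ⟨lipFreeToBidual X μ, lipFreeToBidual_mem_range X μ⟩
  have h' := congrArg (fun z => (Subtype.val z) e) h
  exact h'

/-- `β_X ∘ δ_X` is the identity of `X`. -/
theorem lipBeta_lipDelta (x : X) : lipBeta X (lipDelta x) = x := by
  refine (SeparatingDual.eq_iff_forall_dual_eq (R := ℝ)).2 fun e => ?_
  rw [dual_lipBeta]
  rfl

end LipFree

/-! ### p-compact sets, the topology τ_p and the approximation properties -/

section PCompact

variable {X : Type u} {Y : Type v} [NormedAddCommGroup X] [NormedSpace ℝ X]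
  [NormedAddCommGroup Y] [NormedSpace ℝ Y]

/-- The `p`-convex hull `{∑ aₙ xₙ : (aₙ) ∈ B_{ℓ_{p'}}}` of a sequence, where `p'` is the
conjugate exponent of `p` (so `p' = ∞` for `p = 1`). -/
def pConvexHull (p : ℝ≥0∞) (x : ℕ → X) : Set X :=
  {y | ∃ a : lp (fun _ : ℕ => ℝ) (ENNReal.conjExponent p), ‖a‖ ≤ 1 ∧
    HasSum (fun n => a n • x n) y}

/-- `K` is relatively `p`-compact: it lies in the `p`-convex hull of a strongly `p`-summable
sequence. -/
def IsRelPCompact (p : ℝ≥0∞) (K : Set X) : Prop :=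
  ∃ x : ℕ → X, Memℓp x p ∧ K ⊆ pConvexHull p x

/-- `K` is `p`-compact: relatively `p`-compact and compact. (In a Banach space a relatively
`p`-compact set is relatively compact, so here compact amounts to closed.) -/
def IsPCompact (p : ℝ≥0∞) (K : Set X) : Prop :=
  IsCompact K ∧ IsRelPCompact p K

/-- The closure of a set `S` of maps `X → Y` in the topology `τ_p` of uniform convergence on
the `p`-compact subsets of `X`. -/
def tauPClosure (p : ℝ≥0∞) (S : Set (X → Y)) : Set (X → Y) :=
  {f | UniformOnFun.ofFun {K : Set X | IsPCompact p K} f ∈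
    closure (UniformOnFun.ofFun {K : Set X | IsPCompact p K} '' S)}

variable (X Y)

/-- `𝓕(X, Y)`: the bounded linear operators of finite rank, as maps. -/
def finiteRankOps : Set (X → Y) :=
  {f | ∃ T : X →L[ℝ] Y, FiniteDimensional ℝ T.range ∧ ⇑T = f}

/-- `Lip₀_𝓕(X, Y)`: the Lipschitz maps vanishing at zero whose range spans a
finite-dimensional space, as maps. -/
def lipFiniteRankOps : Set (X → Y) :=
  {f | ∃ g : LipZero X Y, FiniteDimensional ℝ (Submodule.span ℝ (Set.range g)) ∧ ⇑g = f}

/-- The `p`-approximation property. -/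
def HasPAP (p : ℝ≥0∞) : Prop :=
  ∀ K : Set X, IsPCompact p K → ∀ ε : ℝ, 0 < ε →
    ∃ T : X →L[ℝ] X, FiniteDimensional ℝ T.range ∧ ∀ x ∈ K, ‖T x - x‖ < ε

/-- The Lipschitz `p`-approximation property: the identity lies in the `τ_p`-closure of
`Lip₀_𝓕(X, X)`. -/
def HasLipPAP (p : ℝ≥0∞) : Prop :=
  (id : X → X) ∈ tauPClosure p (lipFiniteRankOps X X)

end PCompact

end

noncomputable section SegmentAverage

open Filter Topology MeasureTheory

variable {E V : Type*} [NormedAddCommGroup E] [NormedSpace ℝ E] [NormedAddCommGroup V]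

theorem intervalIntegrable_comp_segment {g : E → V} (hg : Continuous g) (x y : E) (a b : ℝ) :
    IntervalIntegrable (fun t : ℝ => g (y + t • x)) volume a b :=
  Continuous.intervalIntegrable (by fun_prop) _ _

variable [NormedSpace ℝ V]

/-- The average of `g` over the segments `[y, y + x]`, as a function of `y`. -/
def segmentAverage (x : E) (g : E → V) (y : E) : V :=
  ∫ t in (0 : ℝ)..1, g (y + t • x)

theorem LipschitzWith.segmentAverage {C : ℝ≥0} {g : E → V} (hg : LipschitzWith C g) (x : E) :
    LipschitzWith C (segmentAverage x g) := by
  refine LipschitzWith.of_dist_le_mul fun y z => ?_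
  rw [dist_eq_norm, _root_.segmentAverage, _root_.segmentAverage,
    ← intervalIntegral.integral_sub (intervalIntegrable_comp_segment hg.continuous _ _ _ _)
      (intervalIntegrable_comp_segment hg.continuous _ _ _ _)]
  refine (intervalIntegral.norm_integral_le_of_norm_le_const
    (C := C * dist y z) fun t _ => ?_).trans_eq (by simp)
  simpa [dist_eq_norm] using hg.dist_le_mul (y + t • x) (z + t • x)

theorem norm_segmentAverage_sub_le [CompleteSpace V] {C : ℝ≥0} {g : E → V}
    (hg : LipschitzWith C g) (x y : E) :
    ‖segmentAverage x g y - g y‖ ≤ C * ‖x‖ := by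
  have h : g y = ∫ _ in (0 : ℝ)..1, g y := by simp
  conv_lhs => rw [h]
  rw [segmentAverage, ← intervalIntegral.integral_sub
    (intervalIntegrable_comp_segment hg.continuous _ _ _ _) (by simp)]
  refine (intervalIntegral.norm_integral_le_of_norm_le_const
    (C := C * ‖x‖) fun t ht => ?_).trans_eq (by simp)
  rw [Set.uIoc_of_le zero_le_one] at ht
  refine (hg.norm_sub_le _ _).trans ?_
  rw [add_sub_cancel_left, norm_smul, Real.norm_of_nonneg ht.1.le]
  gcongr
  exact mul_le_of_le_one_left (norm_nonneg _) ht.2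

theorem ContinuousLinearMap.segmentAverage_comp [CompleteSpace V] {W : Type*}
    [NormedAddCommGroup W] [NormedSpace ℝ W] [CompleteSpace W] (B : V →L[ℝ] W) {g : E → V}
    (hg : Continuous g) (x y : E) :
    B (segmentAverage x g y) = segmentAverage x (B ∘ g) y :=
  (B.intervalIntegral_comp_comm (intervalIntegrable_comp_segment hg _ _ _ _)).symm

theorem segmentAverage_hasLineDerivAt_self [CompleteSpace V] {g : E → V} (hg : Continuous g)
    (x y : E) :
    HasLineDerivAt ℝ (segmentAverage x g) (g (y + x) - g y) y x := by
  have hc : Continuous fun t : ℝ => g (y + t • x) := by fun_prop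
  have heq : (fun s : ℝ => segmentAverage x g (y + s • x)) = fun s =>
      (∫ t in (0 : ℝ)..(s + 1), g (y + t • x)) - ∫ t in (0 : ℝ)..s, g (y + t • x) := by
    funext s
    rw [intervalIntegral.integral_interval_sub_left (intervalIntegrable_comp_segment hg _ _ _ _)
      (intervalIntegrable_comp_segment hg _ _ _ _), segmentAverage]
    have := intervalIntegral.integral_comp_add_left (a := 0) (b := 1)
      (fun t : ℝ => g (y + t • x)) s
    simp only [add_zero] at this
    rw [← this]
    simp only [add_smul, add_assoc]
  have h1 : HasDerivAt (fun s : ℝ => ∫ t in (0 : ℝ)..s, g (y + t • x)) (g (y + (0 + 1 : ℝ) • x))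
      (0 + 1) := hc.integral_hasStrictDerivAt 0 _ |>.hasDerivAt
  have h0 : HasDerivAt (fun s : ℝ => ∫ t in (0 : ℝ)..s, g (y + t • x)) (g (y + (0 : ℝ) • x))
      0 := hc.integral_hasStrictDerivAt 0 _ |>.hasDerivAt
  rw [HasLineDerivAt, heq]
  simpa using! (h1.comp_add_const 0 1).sub h0

theorem HasLineDerivAt.segmentAverage {C : ℝ≥0} {g h : E → V}
    (hg : LipschitzWith C g) (hh : Continuous h) {z : E}
    (hd : ∀ y, HasLineDerivAt ℝ g (h y) y z) (x y : E) :
    HasLineDerivAt ℝ (segmentAverage x g) (segmentAverage x h y) y z := by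
  have hgc := hg.continuous
  refine (intervalIntegral.hasDerivAt_integral_of_dominated_loc_of_lip
    (F := fun s t => g (y + s • z + t • x)) (F' := fun t => h (y + t • x))
    (bound := fun _ => C * ‖z‖) univ_mem ?_ ?_ ?_ ?_ ?_ ?_).2
  · exact Eventually.of_forall fun s => Continuous.aestronglyMeasurable (by fun_prop)
  · exact Continuous.intervalIntegrable (by fun_prop) _ _
  · exact Continuous.aestronglyMeasurable (by fun_prop)
  · refine Eventually.of_forall fun t _ => LipschitzWith.lipschitzOnWith ?_
    refine LipschitzWith.of_dist_le_mul fun s r => ?_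
    refine (hg.dist_le_mul _ _).trans ?_
    rw [dist_eq_norm, dist_eq_norm, Real.coe_nnabs,
      abs_of_nonneg (show (0 : ℝ) ≤ C * ‖z‖ by positivity), mul_assoc]
    gcongr
    rw [add_sub_add_right_eq_sub, add_sub_add_left_eq_sub, ← sub_smul, norm_smul, mul_comm]
  · simp
  · refine Eventually.of_forall fun t _ => ?_
    have := hd (y + t • x)
    rw [HasLineDerivAt] at this
    simpa only [add_right_comm y _ (t • x)] using this

theorem HasLineDerivAt.add_direction {g h : E → V} {A : V} {y w v : E}
    (hw : HasLineDerivAt ℝ g A y w) (hv : ∀ z, HasLineDerivAt ℝ g (h z) z v)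
    (hh : ContinuousAt h y) :
    HasLineDerivAt ℝ g (A + h y) y (w + v) := by
  have hd : ∀ (z : E) (r : ℝ), HasDerivAt (fun s : ℝ => g (z + s • v)) (h (z + r • v)) r := by
    intro z r
    have := hv (z + r • v)
    rw [HasLineDerivAt] at this
    have h2 : HasDerivAt (fun t : ℝ => g (z + r • v + t • v)) (h (z + r • v)) (r - r) := by
      simpa using this
    simpa [add_assoc, ← add_smul] using h2.comp_sub_const r r
  have hsmall : HasDerivAt (fun s : ℝ => g (y + s • w + s • v) - g (y + s • w)) (h y) 0 := by
    rw [hasDerivAt_iff_isLittleO, Asymptotics.isLittleO_iff]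
    intro ε hε
    obtain ⟨δ, hδ, hball⟩ := Metric.continuousAt_iff.1 hh ε hε
    have hlim : ∀ᶠ s : ℝ in 𝓝 0, |s| * (‖w‖ + ‖v‖) < δ := by
      have : Tendsto (fun s : ℝ => |s| * (‖w‖ + ‖v‖)) (𝓝 0) (𝓝 (|(0 : ℝ)| * (‖w‖ + ‖v‖))) :=
        Continuous.tendsto (by fun_prop) 0
      exact this.eventually_lt_const (by simpa using hδ)
    filter_upwards [hlim] with s hs
    have hmv := (convex_uIcc (0 : ℝ) s).norm_image_sub_le_of_norm_hasDerivWithin_le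
      (f := fun r : ℝ => g (y + s • w + r • v) - r • h y)
      (f' := fun r => h (y + s • w + r • v) - h y) (C := ε) (x := 0) (y := s)
      (fun r _ => by
        have := ((hd (y + s • w) r).sub ((hasDerivAt_id r).smul_const (h y))).hasDerivWithinAt
          (s := Set.uIcc 0 s)
        simpa using! this)
      (fun r hr => by
        rw [← dist_eq_norm]
        refine (hball ?_).le
        have hrs : |r| ≤ |s| := by simpa using Set.abs_sub_left_of_mem_uIcc hr
        rw [dist_eq_norm, add_assoc, add_sub_cancel_left]
        refine lt_of_le_of_lt (norm_add_le _ _) (lt_of_le_of_lt ?_ hs)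
        rw [norm_smul, norm_smul, mul_add]
        simp only [Real.norm_eq_abs]
        gcongr) Set.left_mem_uIcc Set.right_mem_uIcc
    simp only [zero_smul, add_zero, sub_zero, sub_self] at hmv ⊢
    refine le_of_eq_of_le ?_ hmv
    congr 1
    abel
  have := HasDerivAt.add hw hsmall
  refine HasDerivAt.congr_of_eventuallyEq this (Eventually.of_forall fun s => ?_)
  simp [smul_add, add_assoc]

theorem HasLineDerivAt.sum_smul_direction {ι : Type*} {g : E → V} {h : ι → E → V} {v : ι → E}
    (s : Finset ι) (a : ι → ℝ) (hv : ∀ i ∈ s, ∀ z, HasLineDerivAt ℝ g (h i z) z (v i))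
    (hh : ∀ i ∈ s, Continuous (h i)) (y : E) :
    HasLineDerivAt ℝ g (∑ i ∈ s, a i • h i y) y (∑ i ∈ s, a i • v i) := by
  classical
  induction s using Finset.induction_on with
  | empty => simp [HasLineDerivAt, hasDerivAt_const]
  | insert i s hi ih =>
    rw [Finset.sum_insert hi, Finset.sum_insert hi, add_comm, add_comm (a i • v i)]
    refine (ih (fun j hj => hv j (Finset.mem_insert_of_mem hj))
      fun j hj => hh j (Finset.mem_insert_of_mem hj)).add_direction (h := fun z => a i • h i z)
      (fun z => (hv i (Finset.mem_insert_self i s) z).smul (a i)) ?_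
    exact ((hh i (Finset.mem_insert_self i s)).const_smul (a i)).continuousAt

end SegmentAverage

noncomputable section Lifting

open Filter Topology

variable {E V : Type*} [NormedAddCommGroup E] [NormedSpace ℝ E]
  [NormedAddCommGroup V] [NormedSpace ℝ V]

/-- The average of `g` over the segments in the first `n` directions of the sequence `x`. -/
def iteratedAverage (x : ℕ → E) (g : E → V) : ℕ → E → V
  | 0 => g
  | n + 1 => segmentAverage (x n) (iteratedAverage x g n)

/-- The derivative of `iteratedAverage x g (k + 1 + n)` in the direction `x k`. -/
def iteratedAverageDeriv (x : ℕ → E) (g : E → V) (k : ℕ) : ℕ → E → V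
  | 0 => fun y => iteratedAverage x g k (y + x k) - iteratedAverage x g k y
  | n + 1 => segmentAverage (x (k + 1 + n)) (iteratedAverageDeriv x g k n)

variable {g : E → V} (hg : LipschitzWith 1 g) (x : ℕ → E)
include hg

theorem lipschitzWith_iteratedAverage (n : ℕ) : LipschitzWith 1 (iteratedAverage x g n) := by
  induction n with
  | zero => exact hg
  | succ n ih => exact ih.segmentAverage _

theorem lipschitzWith_iteratedAverageDeriv (k n : ℕ) :
    LipschitzWith 2 (iteratedAverageDeriv x g k n) := by
  induction n with
  | zero =>
    have h := lipschitzWith_iteratedAverage hg x k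
    have h2 : LipschitzWith 1 fun y => iteratedAverage x g k (y + x k) := by
      simpa using! h.comp (isometry_add_right (x k)).lipschitz
    have := h2.sub h
    rwa [one_add_one_eq_two] at this
  | succ n ih => exact ih.segmentAverage _

variable [CompleteSpace V]

theorem iteratedAverage_hasLineDerivAt (k n : ℕ) (y : E) :
    HasLineDerivAt ℝ (iteratedAverage x g (k + 1 + n)) (iteratedAverageDeriv x g k n y) y
      (x k) := by
  induction n generalizing y with
  | zero =>
    exact segmentAverage_hasLineDerivAt_self (lipschitzWith_iteratedAverage hg x k).continuous _ _
  | succ n ih =>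
    exact HasLineDerivAt.segmentAverage (lipschitzWith_iteratedAverage hg x _)
      (lipschitzWith_iteratedAverageDeriv hg x k n).continuous ih _ _

theorem norm_iteratedAverageDeriv_succ_sub_le (k n : ℕ) (y : E) :
    ‖iteratedAverageDeriv x g k (n + 1) y - iteratedAverageDeriv x g k n y‖ ≤
      2 * ‖x (k + 1 + n)‖ :=
  norm_segmentAverage_sub_le (lipschitzWith_iteratedAverageDeriv hg x k n) _ _

theorem norm_sum_iteratedAverageDeriv_le (s : Finset ℕ) (a : ℕ → ℝ) {N : ℕ}
    (hN : ∀ k ∈ s, k < N) (y : E) :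
    ‖∑ k ∈ s, a k • iteratedAverageDeriv x g k (N - (k + 1)) y‖ ≤ ‖∑ k ∈ s, a k • x k‖ := by
  have h := HasLineDerivAt.sum_smul_direction (g := iteratedAverage x g N)
    (h := fun k => iteratedAverageDeriv x g k (N - (k + 1))) (v := x) s a
    (fun k hk z => by
      have := iteratedAverage_hasLineDerivAt hg x k (N - (k + 1)) z
      rwa [Nat.add_sub_cancel' (hN k hk)] at this)
    (fun k _ => (lipschitzWith_iteratedAverageDeriv hg x k _).continuous) y
  simpa using h.le_of_lipschitz (lipschitzWith_iteratedAverage hg x N)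

variable [CompleteSpace E] (B : V →L[ℝ] E) (hB : ∀ y, B (g y) = y)
include hB

theorem leftInverse_iteratedAverage (n : ℕ) :
    ∃ c : E, ∀ y, B (iteratedAverage x g n y) = y + c := by
  induction n with
  | zero => exact ⟨0, fun y => by simp [iteratedAverage, hB]⟩
  | succ n ih =>
    obtain ⟨c, hc⟩ := ih
    refine ⟨c + ∫ t in (0 : ℝ)..1, t • x n, fun y => ?_⟩
    rw [iteratedAverage, B.segmentAverage_comp
      (lipschitzWith_iteratedAverage hg x n).continuous, segmentAverage]
    have : ∀ t : ℝ, (⇑B ∘ iteratedAverage x g n) (y + t • x n) = (y + c) + t • x n := by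
      intro t
      rw [Function.comp_apply, hc]
      abel
    simp only [this]
    rw [intervalIntegral.integral_add (by simp) (Continuous.intervalIntegrable (by fun_prop) _ _)]
    simp [add_assoc]

theorem leftInverse_iteratedAverageDeriv (k n : ℕ) (y : E) :
    B (iteratedAverageDeriv x g k n y) = x k := by
  obtain ⟨c, hc⟩ := leftInverse_iteratedAverage hg x B hB (k + 1 + n)
  have h1 : HasDerivAt (fun t : ℝ => B (iteratedAverage x g (k + 1 + n) (y + t • x k)))
      (B (iteratedAverageDeriv x g k n y)) 0 :=
    B.hasFDerivAt.comp_hasDerivAt _ (iteratedAverage_hasLineDerivAt hg x k n y)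
  have h2 : HasDerivAt (fun t : ℝ => B (iteratedAverage x g (k + 1 + n) (y + t • x k)))
      (x k) 0 := by
    simp only [hc]
    simpa using! (((hasDerivAt_id (0 : ℝ)).smul_const (x k)).const_add y).add_const c
  exact h1.unique h2

theorem exists_lift_of_norm_le (hx : ∀ n, ‖x n‖ ≤ (1 / 2) ^ n) :
    ∃ μ : ℕ → V, (∀ n, B (μ n) = x n) ∧
      ∀ (s : Finset ℕ) (a : ℕ → ℝ), ‖∑ n ∈ s, a n • μ n‖ ≤ ‖∑ n ∈ s, a n • x n‖ := by
  have hlim : ∀ k, ∃ m, Tendsto (fun n => iteratedAverageDeriv x g k n 0) atTop (𝓝 m) := by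
    intro k
    refine cauchySeq_tendsto_of_complete
      (cauchySeq_of_le_geometric (1 / 2) 2 (by norm_num) fun n => ?_)
    rw [dist_comm, dist_eq_norm]
    refine (norm_iteratedAverageDeriv_succ_sub_le hg x k n 0).trans ?_
    gcongr
    exact (hx _).trans (pow_le_pow_of_le_one (by norm_num) (by norm_num) (by lia))
  choose μ hμ using hlim
  refine ⟨μ, fun n => ?_, fun s a => ?_⟩
  · refine tendsto_nhds_unique ((B.continuous.tendsto _).comp (hμ n)) ?_
    simp only [Function.comp_def, leftInverse_iteratedAverageDeriv hg x B hB]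
    exact tendsto_const_nhds
  · have ht : Tendsto (fun N => ‖∑ k ∈ s, a k • iteratedAverageDeriv x g k (N - (k + 1)) 0‖) atTop
        (𝓝 ‖∑ k ∈ s, a k • μ k‖) :=
      (tendsto_finsetSum _ fun k _ =>
        ((hμ k).comp (tendsto_sub_atTop_nat (k + 1))).const_smul (a k)).norm
    refine le_of_tendsto ht ?_
    filter_upwards [eventually_gt_atTop (s.sup id)] with N hN
    exact norm_sum_iteratedAverageDeriv_le hg x s a
      (fun k hk => (Finset.le_sup (f := id) hk).trans_lt hN) 0

theorem exists_lift :
    ∃ μ : ℕ → V, (∀ n, B (μ n) = x n) ∧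
      ∀ (s : Finset ℕ) (a : ℕ → ℝ), ‖∑ n ∈ s, a n • μ n‖ ≤ ‖∑ n ∈ s, a n • x n‖ := by
  set c : ℕ → ℝ := fun n => (1 / 2) ^ n / (‖x n‖ + 1) with hc
  have hc0 : ∀ n, 0 < c n := fun n => by positivity
  obtain ⟨μ, hμ, hle⟩ := exists_lift_of_norm_le hg (fun n => c n • x n) B hB fun n => by
    rw [norm_smul, Real.norm_of_nonneg (hc0 n).le, hc, div_mul_eq_mul_div]
    refine div_le_of_le_mul₀ (by positivity) (by positivity) ?_
    gcongr
    linarith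
  refine ⟨fun n => (c n)⁻¹ • μ n, fun n => ?_, fun s a => ?_⟩
  · rw [map_smul, hμ, inv_smul_smul₀ (hc0 n).ne']
  · have := hle s fun n => a n * (c n)⁻¹
    simp only [mul_smul, inv_smul_smul₀ (hc0 _).ne'] at this
    exact this

/-- A bounded linear left inverse of a `1`-Lipschitz map admits a bounded linear section over
the closed span of any sequence. -/
theorem exists_section_closure_span :
    ∃ U : (Submodule.span ℝ (Set.range x)).topologicalClosure →L[ℝ] V, ∀ z, B (U z) = z := by
  obtain ⟨μ, hμ, hle⟩ := exists_lift hg x B hB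
  set Z := (Submodule.span ℝ (Set.range x)).topologicalClosure
  have hmem : ∀ a : ℕ →₀ ℝ, Finsupp.linearCombination ℝ x a ∈ Z := fun a =>
    Submodule.le_topologicalClosure _ (Finsupp.range_linearCombination ℝ (v := x) ▸
      LinearMap.mem_range_self _ a)
  set e : (ℕ →₀ ℝ) →ₗ[ℝ] Z := (Finsupp.linearCombination ℝ x).codRestrict Z hmem with he
  set f : (ℕ →₀ ℝ) →ₗ[ℝ] V := Finsupp.linearCombination ℝ μ with hf
  have hdense : DenseRange e := by
    have hrange : Subtype.val '' Set.range e = (Submodule.span ℝ (Set.range x) : Set E) := by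
      rw [← Set.range_comp, ← Finsupp.range_linearCombination]
      rfl
    refine Subtype.dense_iff.2 fun z hz => ?_
    have hz' : z ∈ closure (Submodule.span ℝ (Set.range x) : Set E) := hz
    rw [← hrange] at hz'
    exact hz'
  have hnorm : ∃ C, ∀ a, ‖f a‖ ≤ C * ‖e a‖ := ⟨1, fun a => by
    rw [one_mul]
    exact hle a.support a⟩
  refine ⟨f.extendOfNorm e, fun z => ?_⟩
  refine hdense.induction_on z (isClosed_eq (by fun_prop) (by fun_prop)) fun a => ?_
  rw [LinearMap.extendOfNorm_eq hdense hnorm, hf]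
  change B.toLinearMap _ = Finsupp.linearCombination ℝ x a
  rw [Finsupp.apply_linearCombination, ← funext hμ]
  rfl

end Lifting

theorem lipschitzWith_lipDelta {X : Type u} [NormedAddCommGroup X] :
    LipschitzWith 1 (lipDelta : X → LipFree X) := by
  refine LipschitzWith.of_dist_le_mul fun y z => ?_
  rw [NNReal.coe_one, one_mul, dist_eq_norm y z]
  refine (dist_eq_norm (evalAt y) (evalAt z)).trans_le ?_
  refine ContinuousLinearMap.opNorm_le_bound _ (norm_nonneg _) fun f => ?_
  rw [mul_comm]
  exact f.norm_sub_le y z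

/-- The barycentre map admits a bounded linear lifting over the closed span of a sequence. -/
theorem exists_lipBeta_section {X : Type u} [NormedAddCommGroup X] [NormedSpace ℝ X]
    [CompleteSpace X] (x : ℕ → X) :
    ∃ U : (Submodule.span ℝ (Set.range x)).topologicalClosure →L[ℝ] LipFree X,
      ∀ z, lipBeta X (U z) = z :=
  exists_section_closure_span (V := LipFree X) (g := lipDelta) lipschitzWith_lipDelta x
    (lipBeta X) (lipBeta_lipDelta X)

section PCompactFacts

open Filter Topology

variable {X Y : Type*} [NormedAddCommGroup X] [NormedSpace ℝ X]
  [NormedAddCommGroup Y] [NormedSpace ℝ Y]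

theorem norm_rpow_extend_zero {E : Type*} [NormedAddCommGroup E] {e : ℕ → ℕ}
    (he : Function.Injective e) (x : ℕ → E) {r : ℝ} (hr : 0 < r) :
    (fun n => ‖Function.extend e x 0 n‖ ^ r) = Function.extend e (fun n => ‖x n‖ ^ r) 0 := by
  funext n
  by_cases h : ∃ k, e k = n
  · obtain ⟨k, rfl⟩ := h
    rw [he.extend_apply, he.extend_apply]
  · rw [Function.extend_apply' _ _ _ h, Function.extend_apply' _ _ _ h]
    simp [hr.ne']

theorem norm_extend_zero_le {E : Type*} [NormedAddCommGroup E] {e : ℕ → ℕ}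
    (he : Function.Injective e) (x : ℕ → E) {C : ℝ} (hC : 0 ≤ C) (hx : ∀ n, ‖x n‖ ≤ C) (n : ℕ) :
    ‖Function.extend e x 0 n‖ ≤ C := by
  by_cases h : ∃ k, e k = n
  · obtain ⟨k, rfl⟩ := h
    rw [he.extend_apply]
    exact hx k
  · rw [Function.extend_apply' _ _ _ h]
    simpa using hC

theorem exists_lp_extend_zero {q : ℝ≥0∞} (hq : q ≠ 0) {e : ℕ → ℕ} (he : Function.Injective e)
    (a : lp (fun _ : ℕ => ℝ) q) :
    ∃ b : lp (fun _ : ℕ => ℝ) q, (⇑b : ℕ → ℝ) = Function.extend e a 0 ∧ ‖b‖ ≤ ‖a‖ := by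
  rcases q.trichotomy with rfl | rfl | h
  · exact absurd rfl hq
  · have hle := norm_extend_zero_le he a (lp.norm_nonneg' a) (lp.norm_apply_le_norm hq a)
    exact ⟨⟨Function.extend e a 0, memℓp_infty ⟨‖a‖, by rintro _ ⟨n, rfl⟩; exact hle n⟩⟩, rfl,
      lp.norm_le_of_forall_le (lp.norm_nonneg' a) hle⟩
  · have hs : HasSum (fun n => ‖Function.extend e a 0 n‖ ^ q.toReal) (‖a‖ ^ q.toReal) := by
      rw [norm_rpow_extend_zero he _ h, hasSum_extend_zero he]
      exact lp.hasSum_norm h a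
    exact ⟨⟨Function.extend e a 0, memℓp_gen hs.summable⟩, rfl,
      lp.norm_le_of_tsum_le h (lp.norm_nonneg' a) hs.tsum_eq.le⟩

theorem Memℓp.extend_zero {X : Type*} [NormedAddCommGroup X] {p : ℝ≥0∞} (hp : p ≠ 0) (hp' : p ≠ ∞) {e : ℕ → ℕ}
    (he : Function.Injective e) {x : ℕ → X} (hx : Memℓp x p) :
    Memℓp (Function.extend e x 0) p := by
  have h := ENNReal.toReal_pos hp hp'
  rw [memℓp_gen_iff h] at hx ⊢
  rw [norm_rpow_extend_zero he _ h]
  exact ((hasSum_extend_zero he).2 hx.hasSum).summable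

theorem pConvexHull_subset_of_comp {p : ℝ≥0∞} {e : ℕ → ℕ}
    (he : Function.Injective e) {x z : ℕ → X} (hz : ∀ n, z (e n) = x n) :
    pConvexHull p x ⊆ pConvexHull p z := by
  have hq : ENNReal.conjExponent p ≠ 0 := by simp [ENNReal.conjExponent]
  rintro y ⟨a, ha, hy⟩
  obtain ⟨b, hb, hba⟩ := exists_lp_extend_zero hq he a
  refine ⟨b, hba.trans ha, ?_⟩
  have : (fun n => b n • z n) = Function.extend e (fun n => a n • x n) 0 := by
    funext n
    rw [hb]
    by_cases h : ∃ k, e k = n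
    · obtain ⟨k, rfl⟩ := h
      rw [he.extend_apply, he.extend_apply, hz]
    · rw [Function.extend_apply' _ _ _ h, Function.extend_apply' _ _ _ h]
      simp
  rw [this, hasSum_extend_zero he]
  exact hy

theorem IsPCompact.union {p : ℝ≥0∞} (hp : 1 ≤ p) (hp' : p ≠ ∞) {K L : Set X}
    (hK : IsPCompact p K) (hL : IsPCompact p L) : IsPCompact p (K ∪ L) := by
  obtain ⟨hK, x, hx, hKx⟩ := hK
  obtain ⟨hL, y, hy, hLy⟩ := hL
  have h0 : p ≠ 0 := (one_pos.trans_le hp).ne'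
  have he : Function.Injective fun n : ℕ => 2 * n := fun a b h => by simpa using h
  have ho : Function.Injective fun n : ℕ => 2 * n + 1 := fun a b h => by simpa using h
  refine ⟨hK.union hL, _, (hx.extend_zero h0 hp' he).add (hy.extend_zero h0 hp' ho),
    Set.union_subset (hKx.trans (pConvexHull_subset_of_comp he fun n => ?_))
      (hLy.trans (pConvexHull_subset_of_comp ho fun n => ?_))⟩
  · rw [Pi.add_apply, he.extend_apply, Function.extend_apply' _ _ _ (by rintro ⟨k, hk⟩; grind)]
    simp
  · rw [Pi.add_apply, ho.extend_apply, Function.extend_apply' _ _ _ (by rintro ⟨k, hk⟩; grind)]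
    simp

theorem isPCompact_empty (p : ℝ≥0∞) : IsPCompact p (∅ : Set X) :=
  ⟨isCompact_empty, 0, zero_memℓp, Set.empty_subset _⟩

theorem IsPCompact.image {p : ℝ≥0∞} {K : Set X} (hK : IsPCompact p K) (T : X →L[ℝ] Y) :
    IsPCompact p (T '' K) := by
  obtain ⟨hK, x, hx, hKx⟩ := hK
  refine ⟨hK.image T.continuous, fun n => T (x n), ?_, ?_⟩
  · refine (hx.norm.const_mul ‖T‖).mono fun n => ?_
    exact T.le_opNorm _
  · rintro _ ⟨z, hz, rfl⟩
    obtain ⟨a, ha, hs⟩ := hKx hz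
    exact ⟨a, ha, by simpa using! hs.mapL T⟩

omit [NormedSpace ℝ Y] in
theorem mem_tauPClosure_iff {p : ℝ≥0∞} (hp : 1 ≤ p) (hp' : p ≠ ∞) {S : Set (X → Y)}
    {f : X → Y} :
    f ∈ tauPClosure p S ↔ ∀ K : Set X, IsPCompact p K → ∀ ε : ℝ, 0 < ε →
      ∃ g ∈ S, ∀ x ∈ K, ‖g x - f x‖ < ε := by
  have hb := UniformOnFun.hasBasis_nhds_of_basis X Y {K : Set X | IsPCompact p K}
    (UniformOnFun.ofFun {K : Set X | IsPCompact p K} f) ⟨∅, isPCompact_empty p⟩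
    (fun K hK L hL => ⟨K ∪ L, IsPCompact.union hp hp' hK hL, Set.subset_union_left,
      Set.subset_union_right⟩) Metric.uniformity_basis_dist
  refine (mem_closure_iff_nhds_basis hb).trans ⟨?_, ?_⟩
  · intro h K hK ε hε
    obtain ⟨_, ⟨g, hg, rfl⟩, hgf⟩ := h (K, ε) ⟨hK, hε⟩
    exact ⟨g, hg, fun x hx => by rw [← dist_eq_norm]; exact hgf x hx⟩
  · rintro h ⟨K, ε⟩ ⟨hK, hε⟩
    obtain ⟨g, hg, hgf⟩ := h K hK ε hε
    exact ⟨_, ⟨g, hg, rfl⟩, fun x hx => by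
      have := hgf x hx
      rw [← dist_eq_norm] at this
      exact this⟩

omit [NormedSpace ℝ Y] in
theorem tauPClosure_mono {p : ℝ≥0∞} {S S' : Set (X → Y)} (h : S ⊆ S') :
    tauPClosure p S ⊆ tauPClosure p S' := fun _ hf =>
  closure_mono (X := UniformOnFun X Y {K : Set X | IsPCompact p K}) (Set.image_mono h) hf

theorem comp_mem_finiteRankOps {Z : Type*} [NormedAddCommGroup Z] [NormedSpace ℝ Z]
    {f : X → Y} (hf : f ∈ finiteRankOps X Y) (T : Z →L[ℝ] X) :
    f ∘ T ∈ finiteRankOps Z Y := by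
  obtain ⟨S, hS, rfl⟩ := hf
  refine ⟨S.comp T, ?_, rfl⟩
  exact Submodule.finiteDimensional_of_le (LinearMap.range_comp_le_range T.toLinearMap S.toLinearMap)

theorem clm_comp_mem_finiteRankOps {Z : Type*} [NormedAddCommGroup Z] [NormedSpace ℝ Z]
    {f : X → Y} (hf : f ∈ finiteRankOps X Y) (T : Y →L[ℝ] Z) :
    T ∘ f ∈ finiteRankOps X Z := by
  obtain ⟨S, hS, rfl⟩ := hf
  refine ⟨T.comp S, ?_, rfl⟩
  change FiniteDimensional ℝ (LinearMap.range (T.toLinearMap ∘ₗ S.toLinearMap))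
  rw [LinearMap.range_comp]
  infer_instance

theorem comp_mem_tauPClosure {Z : Type*} [NormedAddCommGroup Z] [NormedSpace ℝ Z] {p : ℝ≥0∞}
    (hp : 1 ≤ p) (hp' : p ≠ ∞) {f : X → Y} (hf : f ∈ tauPClosure p (finiteRankOps X Y))
    (T : Z →L[ℝ] X) : f ∘ T ∈ tauPClosure p (finiteRankOps Z Y) := by
  rw [mem_tauPClosure_iff hp hp'] at hf ⊢
  intro K hK ε hε
  obtain ⟨g, hg, h⟩ := hf _ (hK.image T) ε hε
  exact ⟨g ∘ T, comp_mem_finiteRankOps hg T, fun x hx => h _ ⟨x, hx, rfl⟩⟩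

theorem clm_comp_mem_tauPClosure {Z : Type*} [NormedAddCommGroup Z] [NormedSpace ℝ Z]
    {p : ℝ≥0∞} (hp : 1 ≤ p) (hp' : p ≠ ∞) {f : X → Y}
    (hf : f ∈ tauPClosure p (finiteRankOps X Y)) (T : Y →L[ℝ] Z) :
    T ∘ f ∈ tauPClosure p (finiteRankOps X Z) := by
  rw [mem_tauPClosure_iff hp hp'] at hf ⊢
  intro K hK ε hε
  obtain ⟨g, hg, h⟩ := hf K hK (ε / (‖T‖ + 1)) (by positivity)
  refine ⟨T ∘ g, clm_comp_mem_finiteRankOps hg T, fun x hx => ?_⟩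
  rw [Function.comp_apply, Function.comp_apply, ← map_sub]
  refine lt_of_le_of_lt (T.le_opNorm _) ?_
  calc ‖T‖ * ‖g x - f x‖ ≤ (‖T‖ + 1) * ‖g x - f x‖ := by gcongr; linarith
    _ < (‖T‖ + 1) * (ε / (‖T‖ + 1)) := by gcongr; exact h x hx
    _ = ε := by field_simp

theorem hasPAP_iff_id_mem_tauPClosure {p : ℝ≥0∞} (hp : 1 ≤ p) (hp' : p ≠ ∞) :
    HasPAP X p ↔ (id : X → X) ∈ tauPClosure p (finiteRankOps X X) := by
  rw [mem_tauPClosure_iff hp hp']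
  refine forall₄_congr fun K _ ε _ => ⟨?_, ?_⟩
  · rintro ⟨T, hT, h⟩
    exact ⟨T, ⟨T, hT, rfl⟩, h⟩
  · rintro ⟨_, ⟨T, hT, rfl⟩, h⟩
    exact ⟨T, hT, h⟩

theorem finiteRankOps_subset_lipFiniteRankOps :
    finiteRankOps X Y ⊆ lipFiniteRankOps X Y := by
  rintro _ ⟨T, hT, rfl⟩
  refine ⟨(⟨T, ⟨‖T‖₊, T.lipschitz⟩, map_zero T⟩ : ↥(lipZeroSubmodule X Y)), ?_, rfl⟩
  exact Submodule.finiteDimensional_of_le (S₂ := T.range)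
    (Submodule.span_le.2 (by rintro _ ⟨x, rfl⟩; exact ⟨x, rfl⟩))

theorem IsPCompact.preimage_subtype_val {p : ℝ≥0∞} {Z : Submodule ℝ X}
    (hZ : IsClosed (Z : Set X)) {K : Set X} (hK : IsCompact K) {x : ℕ → Z}
    (hx : Memℓp (fun n => (x n : X)) p) (hKx : K ⊆ pConvexHull p fun n => (x n : X)) :
    IsPCompact p (Subtype.val ⁻¹' K : Set Z) := by
  refine ⟨hZ.isClosedEmbedding_subtypeVal.isCompact_preimage hK, x, ?_, ?_⟩
  · exact hx.mono' fun n => le_rfl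
  · intro z hz
    obtain ⟨a, ha, hs⟩ := hKx hz
    refine ⟨a, ha, ?_⟩
    exact (Topology.IsInducing.subtypeVal.hasSum_iff (g := Z.subtype) _ _).1 hs

theorem finiteRankOps_extend {Z : Submodule ℝ X} {f : Z → Y} (hf : f ∈ finiteRankOps Z Y) :
    ∃ g ∈ finiteRankOps X Y, ∀ z : Z, g z = f z := by
  obtain ⟨S, hS, rfl⟩ := hf
  let R : Z →L[ℝ] S.range := S.codRestrict _ fun z => ⟨z, rfl⟩
  have : FiniteDimensional ℝ R.range := FiniteDimensional.finiteDimensional_submodule _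
  obtain ⟨G, hG⟩ := R.exist_extension_of_finiteDimensional_range
  refine ⟨S.range.subtypeL ∘ G, clm_comp_mem_finiteRankOps
    ⟨G, FiniteDimensional.finiteDimensional_submodule _, rfl⟩ _, fun z => ?_⟩
  exact (congrArg (fun F : Z →L[ℝ] S.range => (F z : Y)) hG).symm

theorem mem_tauPClosure_of_comp_lipBeta [CompleteSpace X] {p : ℝ≥0∞} (hp : 1 ≤ p) (hp' : p ≠ ∞)
    {T : X → Y} (hT : T ∘ lipBeta X ∈ tauPClosure p (finiteRankOps (LipFree X) Y)) :
    T ∈ tauPClosure p (finiteRankOps X Y) := by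
  rw [mem_tauPClosure_iff hp hp'] at hT ⊢
  rintro K ⟨hK, x, hx, hKx⟩ ε hε
  set Z := (Submodule.span ℝ (Set.range x)).topologicalClosure with hZ
  obtain ⟨U, hU⟩ : ∃ U : Z →L[ℝ] LipFree X, ∀ z, lipBeta X (U z) = z :=
    exists_lipBeta_section x
  have hZc : IsClosed (Z : Set X) := Submodule.isClosed_topologicalClosure _
  have hxZ : ∀ n, x n ∈ Z := fun n =>
    Submodule.le_topologicalClosure _ (Submodule.subset_span ⟨n, rfl⟩)
  have hKZ : K ⊆ Z := fun y hy => by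
    obtain ⟨a, -, hs⟩ := hKx hy
    exact hZc.mem_of_tendsto hs (.of_forall fun s => Z.sum_mem fun n _ => Z.smul_mem _ (hxZ n))
  have hK' : IsPCompact p (Subtype.val ⁻¹' K : Set Z) :=
    .preimage_subtype_val hZc hK (x := fun n => ⟨x n, hxZ n⟩) hx hKx
  obtain ⟨S, hS, hSK⟩ := hT _ (hK'.image U) ε hε
  obtain ⟨g, hg, hgS⟩ := finiteRankOps_extend (comp_mem_finiteRankOps hS U)
  refine ⟨g, hg, fun y hy => ?_⟩
  have := hSK _ ⟨⟨y, hKZ hy⟩, hy, rfl⟩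
  rw [Function.comp_apply, hU] at this
  rwa [hgS ⟨y, hKZ hy⟩]

end PCompactFacts

theorem lemma3p9 (p : ℝ≥0∞) (hp : 1 ≤ p) (hp' : p ≠ ∞)
    (X : Type u) [NormedAddCommGroup X] [NormedSpace ℝ X] [CompleteSpace X] :
    (∀ (Y : Type v) [NormedAddCommGroup Y] [NormedSpace ℝ Y] [CompleteSpace Y],
      (∀ T : X →L[ℝ] Y, (⇑T : X → Y) ∈ tauPClosure p (finiteRankOps X Y)) ↔
        ∀ T : X →L[ℝ] Y,
          (⇑(T.comp (lipBeta X)) : LipFree X → Y) ∈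
            tauPClosure p (finiteRankOps (LipFree X) Y)) ∧
    (HasPAP X p ↔
      ∀ (Y : Type (max u v)) [NormedAddCommGroup Y] [NormedSpace ℝ Y] [CompleteSpace Y]
        (T : X →L[ℝ] Y),
          (⇑(T.comp (lipBeta X)) : LipFree X → Y) ∈
            tauPClosure p (finiteRankOps (LipFree X) Y)) ∧
    (HasPAP (LipFree X) p → HasPAP X p ∧ HasLipPAP X p) := by
  refine ⟨fun Y _ _ _ => ⟨fun h T => by
      have := comp_mem_tauPClosure (Z := LipFree X) hp hp' (h T) (lipBeta X)
      exact this,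
    fun h T => mem_tauPClosure_of_comp_lipBeta hp hp' (h T)⟩, ⟨fun h Y _ _ _ T => ?_, fun h => ?_⟩,
    fun h => ?_⟩
  · rw [hasPAP_iff_id_mem_tauPClosure hp hp'] at h
    exact comp_mem_tauPClosure (Z := LipFree X) hp hp' (clm_comp_mem_tauPClosure hp hp' h T)
      (lipBeta X)
  · have : CompleteSpace (ULift.{v} X) :=
      (completeSpace_congr (e := Equiv.ulift)
        (ContinuousLinearEquiv.ulift (R₁ := ℝ) (M₁ := X)).isUniformEmbedding).2
        inferInstance
    have h1 := mem_tauPClosure_of_comp_lipBeta hp hp'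
      (h (ULift.{v} X) (ContinuousLinearEquiv.ulift (R₁ := ℝ) (M₁ := X)).symm.toContinuousLinearMap)
    rw [hasPAP_iff_id_mem_tauPClosure hp hp']
    exact clm_comp_mem_tauPClosure hp hp' h1
      (ContinuousLinearEquiv.ulift (R₁ := ℝ) (M₁ := X)).toContinuousLinearMap
  · have hid : (id : X → X) ∈ tauPClosure p (finiteRankOps X X) := by
      rw [hasPAP_iff_id_mem_tauPClosure hp hp'] at h
      exact mem_tauPClosure_of_comp_lipBeta hp hp'
        (clm_comp_mem_tauPClosure hp hp' h (lipBeta X))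
    exact ⟨(hasPAP_iff_id_mem_tauPClosure hp hp').2 hid,
      tauPClosure_mono finiteRankOps_subset_lipFiniteRankOps hid⟩
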